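/- For $\alpha>0$ let $\|Z\|_{\Psi_\alpha}=\inf\{\eta>0:\ \mathbb E[\exp((|Z|/\eta)^\alpha)-1]\le 1\}$ for a real random variable $Z$, and $\|Z\|_{J,\Psi_\alpha}=\sup_{|\theta|_2=1}\|\theta^\top Z\|_{\Psi_\alpha}$ for a random vector $Z$ ((jointly) sub-Weibull($\alpha$) means that this is finite). For a matrix $M$ let $|M|_\infty=\max_{u,v}|M_{u,v}|$. Lemma 2. For every $\alpha>0$ there is a constant $C_\alpha>0$, depending only on $\alpha$, such that the following holds. Let $n\ge 1$, $p\ge 1$, $a\in\mathbb R^p$, and let $X\in\mathbb R^{n\times p}$ be a random matrix whose rows $X_{i,:}$ are i.i.d. with mean $0$ and positive definite covariance $\Sigma$, with largest and smallest eigenvalues $\lambda_{\max},\lambda_{\min}$. Suppose that $$\max\Big(\|\Sigma^{-1/2}X_{i,:}^\top\|_{J,\Psi_\alpha},\ \max_{v}\|X_{i,v}\|_{\Psi_\alpha}\Big)\le\kappa .$$ Let $\kappa^\star=\kappa^2\max\big(|a|_2\sqrt{\lambda_{\max}}/\sqrt{\lambda_{\min}},\,1\big)$ and, with $X_{i,:}$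 and $X_{j,:}$ independent copies of a row, $$\Gamma=\max\Big(\max_v\mathbb E\big[(a^\top\Sigma^{-1}X_{i,:}^\top X_{i,v})^2\big],\ \max_v\mathbb E\big[(a^\top\Sigma^{-1}X_{i,:}^\top X_{j,v})^2\big],\ \max_{u,v}\mathbb E\big[(X_{i,u}X_{i,v})^2\big]\Big).$$ Suppose that $$n>\max\Big\{\frac{4C_\alpha^2(\kappa^\star)^2[\log(2n)]^{4/\alpha}[3\log(pn)]^{4/\min(\alpha,2)-1}}{\Gamma},\ 64\,\Gamma(\log(pn)+2\log p)\Big\}.$$ Let $\mathcal G$ be a non-empty finite set of $n\times n$ matrices satisfying one of the following: (a) each $G\in\mathcal G$ is the matrix of a permutation $g$ of $[n]$ for which there is a partition $[n]=N_1\cup N_2$ into disjoint sets of equal size with $g(N_1)\subseteq N_2$ and $g(N_2)\subseteq N_1$; (b) each $G\in\mathcal G$ is diagonal with diagonal entries $\pm1$, with as many $+1$ as $-1$; (c) there is a partition of $[n]$ into clusters $L_1,\dots,L_{n_c}$ of equal size such that each $G\in\mathcal G$ is block diagonal along the clusters and each block $G_{L_k,L_k}$ is a permutation matrix of the kind in (a)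 on $L_k$. Then $$P\left(\frac1{|\mathcal G|}\sum_{G\in\mathcal G}\Big|\tfrac1n X^\top GX\Big|_\infty\ \ge\ 8\sqrt{\frac{2\Gamma(\log(pn)+2\log p)}{n}}\right)\le\frac{6|\mathcal G|}{np}.$$ -/

import Mathlib

open MeasureTheory ProbabilityTheory Matrix
open scoped ENNReal

/-- The Orlicz (quasi-)norm `inf {η > 0 : 𝔼 Ψ_α(|Z| / η) ≤ 1}` with `Ψ_α(x) = exp (x ^ α) - 1`,
with value `∞` if there is no such `η`. `Z` is sub-Weibull(`α`) when it is finite. -/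
noncomputable def orliczNorm {E : Type*} [MeasurableSpace E] (α : ℝ) (Z : E → ℝ)
    (ν : Measure E) : ℝ≥0∞ :=
  ⨅ (η : ℝ) (_ : 0 < η)
    (_ : ∫⁻ x, ENNReal.ofReal (Real.exp ((|Z x| / η) ^ α) - 1) ∂ν ≤ 1), ENNReal.ofReal η

/-- The joint Orlicz (quasi-)norm of a random vector: the supremum of the Orlicz norms of its
one-dimensional projections along Euclidean unit vectors. -/
noncomputable def jointOrliczNorm {E : Type*} [MeasurableSpace E] {p : ℕ} (α : ℝ)
    (Z : E → Fin p → ℝ) (ν : Measure E) : ℝ≥0∞ :=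
  ⨆ (θ : Fin p → ℝ) (_ : θ ⬝ᵥ θ = 1), orliczNorm α (fun x => θ ⬝ᵥ Z x) ν

/-- The covariance matrix of a law `ν` on `ℝ^p`. -/
noncomputable def covMatrix {p : ℕ} (ν : Measure (Fin p → ℝ)) : Matrix (Fin p) (Fin p) ℝ :=
  Matrix.of fun u v => cov[fun x => x u, fun x => x v; ν]

/-- The largest eigenvalue of a real symmetric matrix. -/
noncomputable def lambdaMax {p : ℕ} (S : Matrix (Fin p) (Fin p) ℝ) : ℝ := sSup (spectrum ℝ S)

/-- The smallest eigenvalue of a real symmetric matrix. -/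
noncomputable def lambdaMin {p : ℕ} (S : Matrix (Fin p) (Fin p) ℝ) : ℝ := sInf (spectrum ℝ S)

/-- `S ^ (-1/2)` for a positive definite matrix `S`, through the functional calculus. -/
noncomputable def invSqrt {p : ℕ} (S : Matrix (Fin p) (Fin p) ℝ) : Matrix (Fin p) (Fin p) ℝ :=
  cfc (fun x : ℝ => (√x)⁻¹) S

/-- The covariate condition: the rows of the random `n × p` matrix `X` are i.i.d. with the
centred law `ν`, whose covariance matrix is positive definite, whose coordinates are
sub-Weibull(`α`) and whose de-correlated version is jointly sub-Weibull(`α`), with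
(quasi-)norms at most `κ`. -/
structure CovariateCondition {Ω : Type*} [MeasurableSpace Ω] {n p : ℕ} (α κ : ℝ)
    (X : Ω → Matrix (Fin n) (Fin p) ℝ) (ν : Measure (Fin p → ℝ)) (μ : Measure Ω) : Prop where
  hasLaw : ∀ i, HasLaw (fun ω => X ω i) ν μ
  indep : iIndepFun (fun i ω => X ω i) μ
  mean_zero : ∀ v, ∫ x, x v ∂ν = 0
  posDef : (covMatrix ν).PosDef
  joint_le : jointOrliczNorm α (fun x => invSqrt (covMatrix ν) *ᵥ x) ν ≤ ENNReal.ofReal κ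
  marginal_le : ∀ v, orliczNorm α (fun x => x v) ν ≤ ENNReal.ofReal κ

/-- The moment quantity `Γ`; the second term is the one with two independent rows. -/
noncomputable def momentGamma {p : ℕ} (a : Fin p → ℝ) (ν : Measure (Fin p → ℝ)) : ℝ :=
  max (⨆ v, ∫ x, ((a ⬝ᵥ ((covMatrix ν)⁻¹ *ᵥ x)) * x v) ^ 2 ∂ν)
    (max (⨆ v, ∫ z, ((a ⬝ᵥ ((covMatrix ν)⁻¹ *ᵥ z.1)) * z.2 v) ^ 2 ∂(ν.prod ν))
      (⨆ u, ⨆ v, ∫ x, (x u * x v) ^ 2 ∂ν))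

/-- `κ⋆ = κ² max(|a|₂ √λ_max / √λ_min, 1)`. -/
noncomputable def kappaStar {p : ℕ} (κ : ℝ) (a : Fin p → ℝ) (ν : Measure (Fin p → ℝ)) : ℝ :=
  κ ^ 2 * max (√(a ⬝ᵥ a) * √(lambdaMax (covMatrix ν)) / √(lambdaMin (covMatrix ν))) 1

/-- The sample size condition with constant `C`. -/
def SampleSizeCondition {p : ℕ} (C α κ : ℝ) (n : ℕ) (a : Fin p → ℝ)
    (ν : Measure (Fin p → ℝ)) : Prop :=
  max (4 * C ^ 2 * kappaStar κ a ν ^ 2 * Real.log (2 * n) ^ (4 / α)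
        * (3 * Real.log (p * n)) ^ (4 / min α 2 - 1) / momentGamma a ν)
      (64 * momentGamma a ν * (Real.log (p * n) + 2 * Real.log p)) < n

/-- Permutation matrices of permutations that swap the two parts of some splitting of the index
set into two disjoint parts of equal size. -/
def crossHalfPermMatrices (ι : Type*) [Fintype ι] [DecidableEq ι] : Set (Matrix ι ι ℝ) :=
  {G | ∃ g : Equiv.Perm ι, ∃ N₁ N₂ : Finset ι,
    Disjoint N₁ N₂ ∧ N₁ ∪ N₂ = Finset.univ ∧ N₁.card = N₂.card ∧
    (∀ j ∈ N₁, g j ∈ N₂) ∧ (∀ j ∈ N₂, g j ∈ N₁) ∧ G = g.permMatrix ℝ}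

/-- Diagonal matrices with diagonal entries `±1`, as many `1` as `-1`. -/
def balancedSignMatrices (ι : Type*) [Fintype ι] [DecidableEq ι] : Set (Matrix ι ι ℝ) :=
  {G | ∃ s : ι → ℝ, (∀ i, s i = 1 ∨ s i = -1) ∧
    Nat.card {i // s i = 1} = Nat.card {i // s i = -1} ∧ G = Matrix.diagonal s}

/-- The family `L` partitions the index set into `c` clusters of equal size. -/
def IsEqualPartition {n c : ℕ} (L : Fin c → Finset (Fin n)) : Prop :=
  Pairwise (fun k l => Disjoint (L k) (L l)) ∧ (∀ i, ∃ k, i ∈ L k) ∧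
    ∃ J : ℕ, n = c * J ∧ ∀ k, (L k).card = J

/-- Matrices that are block diagonal along the clusters `L`, each diagonal block being the
matrix of a permutation swapping two halves of that cluster. -/
def clusterPermMatrices {n c : ℕ} (L : Fin c → Finset (Fin n)) :
    Set (Matrix (Fin n) (Fin n) ℝ) :=
  {G | (∀ k l, k ≠ l → ∀ i ∈ L k, ∀ j ∈ L l, G i j = 0) ∧
    ∀ k, G.submatrix (fun i : L k => (i : Fin n)) (fun i : L k => (i : Fin n))
      ∈ crossHalfPermMatrices (L k)}

/-- The largest absolute value of an entry. -/
noncomputable def maxAbsEntry {p : ℕ} (M : Matrix (Fin p) (Fin p) ℝ) : ℝ :=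
  ⨆ u, ⨆ v, |M u v|

/-- **Chernoff bound** for a sum of independent variables whose exponentials have a common
bound on their means. -/
theorem iIndepFun.measureReal_le_sum_le {ι Ω : Type*} [Fintype ι] [MeasurableSpace Ω]
    {μ : Measure Ω} {f : ι → Ω → ℝ} (hind : iIndepFun f μ) (hm : ∀ i, AEMeasurable (f i) μ)
    (hint : ∀ i, Integrable (fun ω => Real.exp (f i ω)) μ) {b : ℝ}
    (hb : ∀ i, ∫ ω, Real.exp (f i ω) ∂μ ≤ Real.exp b) (x : ℝ) :
    μ.real {ω | x ≤ ∑ i, f i ω} ≤ Real.exp (Fintype.card ι * b - x) := by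
  have : IsProbabilityMeasure μ := hind.isProbabilityMeasure
  have hsum : Integrable (fun ω => Real.exp (1 * (∑ i, f i) ω)) μ := by
    by_contra hcon
    have h := mgf_undef hcon
    rw [hind.mgf_sum₀ hm] at h
    exact (Finset.prod_pos fun i _ => mgf_pos (X := f i) (by simpa using hint i)).ne' h
  have h := measure_ge_le_exp_mul_mgf (X := ∑ i, f i) x zero_le_one hsum
  rw [hind.mgf_sum₀ hm] at h
  simp only [Finset.sum_apply] at h
  refine h.trans ?_
  have h2 : ∏ i, mgf (f i) μ 1 ≤ ∏ _i : ι, Real.exp b :=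
    Finset.prod_le_prod (fun i _ => mgf_nonneg) (fun i _ => by simpa [mgf] using hb i)
  calc Real.exp (-1 * x) * ∏ i, mgf (f i) μ 1
      ≤ Real.exp (-1 * x) * ∏ _i : ι, Real.exp b := by gcongr
    _ = Real.exp (Fintype.card ι * b - x) := by
      rw [Finset.prod_const, ← Real.exp_nat_mul, ← Real.exp_add]
      congr 1
      rw [Finset.card_univ]
      ring

/-- Subadditivity of `x ↦ x ^ q` for `q ≤ 1`. -/
theorem Real.rpow_sum_le_sum_rpow {ι : Type*} (s : Finset ι) {f : ι → ℝ} (hf : ∀ i, 0 ≤ f i)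
    {q : ℝ} (hq : 0 < q) (hq1 : q ≤ 1) : (∑ i ∈ s, f i) ^ q ≤ ∑ i ∈ s, f i ^ q := by
  classical
  induction s using Finset.induction_on with
  | empty => simp [Real.zero_rpow hq.ne']
  | insert a s ha ih =>
    rw [Finset.sum_insert ha, Finset.sum_insert ha]
    refine (Real.rpow_add_le_add_rpow (hf a) (Finset.sum_nonneg fun i _ => hf i) hq.le hq1).trans ?_
    gcongr

/-- Exponential of a truncated variable: the truncation error is absorbed by an exponential
moment. -/
theorem exp_mul_truncation_le {w l M E : ℝ} (hl : |l| * M ≤ 1) (hE : 0 ≤ E)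
    (hw : M < |w| → 1 ≤ E) :
    Real.exp (l * (if |w| ≤ M then w else 0)) ≤ 1 + l * w + 3 / 2 * l ^ 2 * w ^ 2 + E / 2 := by
  split_ifs with h
  · have h1 : |l * w| ≤ 1 := by
      rw [abs_mul]
      exact (mul_le_mul_of_nonneg_left h (abs_nonneg l)).trans hl
    have h2 := (abs_le.1 (Real.abs_exp_sub_one_sub_id_le h1)).2
    nlinarith [sq_nonneg (l * w)]
  · have := hw (not_le.1 h)
    rw [mul_zero, Real.exp_zero]
    nlinarith [sq_nonneg (l * w + 1)]

/-- Exponential of a power of the part of a variable above a truncation level. -/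
theorem exp_half_rpow_tail_le {w K M β L : ℝ} (hK : 0 < K)
    (hM : M < |w| → K ≤ |w| ∧ L ≤ (|w| / K) ^ β) :
    Real.exp (((if |w| ≤ M then 0 else |w|) / K) ^ min β 1 / 2)
      ≤ (if |w| ≤ M then Real.exp (((0 : ℝ) / K) ^ min β 1 / 2) else 0) +
        Real.exp (-(L / 2)) * Real.exp ((|w| / K) ^ β) := by
  split_ifs with h
  · have : 0 ≤ Real.exp (-(L / 2)) * Real.exp ((|w| / K) ^ β) := by positivity
    linarith
  · obtain ⟨h1, h2⟩ := hM (not_le.1 h)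
    have h3 : (|w| / K) ^ min β 1 ≤ (|w| / K) ^ β :=
      Real.rpow_le_rpow_of_exponent_le ((one_le_div hK).2 h1) (min_le_left _ _)
    rw [zero_add, ← Real.exp_add]
    gcongr
    linarith

section Concentration

variable {ι Ω : Type*} [Fintype ι] [MeasurableSpace Ω] {μ : Measure Ω}

theorem measureReal_truncated_sum_le [Nonempty ι] {W : ι → Ω → ℝ} (hind : iIndepFun W μ)
    (hm : ∀ i, AEMeasurable (W i) μ) {K β Γ t M Λ l : ℝ} (ht : Real.log 2 ≤ t) (hΓ : 0 < Γ)
    (hΛ : Real.exp (-(Λ / 2)) = 1 / (2 * Fintype.card ι))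
    (hMΛ : ∀ w : ℝ, M < |w| → K ≤ |w| ∧ Λ ≤ (|w| / K) ^ β)
    (hint : ∀ i, Integrable (W i) μ)
    (hsqi : ∀ i, Integrable (fun ω => W i ω ^ 2) μ) (hsq : ∀ i, ∫ ω, W i ω ^ 2 ∂μ ≤ Γ)
    (hei : ∀ i, Integrable (fun ω => Real.exp ((|W i ω| / K) ^ β)) μ)
    (he : ∀ i, ∫ ω, Real.exp ((|W i ω| / K) ^ β) ∂μ ≤ 2)
    (hMt : M * √t ≤ √(Γ * Fintype.card ι)) (hl : l ^ 2 * (Γ * Fintype.card ι) = t) :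
    μ.real {ω | 4 * t ≤ ∑ i, l * ((if |W i ω| ≤ M then W i ω else 0) - ∫ ω, W i ω ∂μ)}
      ≤ Real.exp (-t) := by
  have : IsProbabilityMeasure μ := hind.isProbabilityMeasure
  set m : ℝ := (Fintype.card ι : ℝ) with hmdef
  have hm1 : 1 ≤ m := by
    rw [hmdef]; exact_mod_cast Fintype.card_pos
  have ht0 : 0.69 ≤ t := by linarith [Real.log_two_gt_d9]
  have hlM : |l| * M ≤ 1 := by
    have hGm : 0 < Γ * m := by positivity
    have h1 : |l| = √t / √(Γ * m) := by
      rw [← Real.sqrt_sq_eq_abs, ← Real.sqrt_div (by linarith), ← hl]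
      congr 1
      field_simp
    rw [h1, div_mul_eq_mul_div, div_le_one (Real.sqrt_pos.2 hGm)]
    linarith
  set g : ℝ → ℝ := fun w => if |w| ≤ M then w else 0 with hg
  have hgm : Measurable g :=
    Measurable.ite (measurableSet_le (by fun_prop) (by fun_prop)) measurable_id measurable_const
  set f : ι → Ω → ℝ := fun i ω => l * (g (W i ω) - ∫ ω, W i ω ∂μ) with hf
  have hfm : ∀ i, AEMeasurable (f i) μ := fun i =>
    ((hgm.comp_aemeasurable (hm i)).sub_const _).const_mul _
  have hfind : iIndepFun f μ :=
    hind.comp (fun i w => l * (g w - ∫ ω, W i ω ∂μ)) (fun i => (hgm.sub_const _).const_mul _)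
  have hpt : ∀ i ω, Real.exp (f i ω) ≤ Real.exp (-(l * ∫ ω, W i ω ∂μ)) *
      (1 + l * W i ω + 3 / 2 * l ^ 2 * W i ω ^ 2 +
        (1 / (2 * m)) ^ 2 * Real.exp ((|W i ω| / K) ^ β) / 2) := by
    intro i ω
    have : f i ω = -(l * ∫ ω, W i ω ∂μ) + l * g (W i ω) := by simp only [hf]; ring
    rw [this, Real.exp_add]
    gcongr
    refine exp_mul_truncation_le hlM (by positivity) fun hw => ?_
    rw [← hΛ, sq, ← Real.exp_add, ← Real.exp_add]
    exact Real.one_le_exp (by linarith [(hMΛ _ hw).2])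
  have hbi : ∀ i, Integrable (fun ω => 1 + l * W i ω + 3 / 2 * l ^ 2 * W i ω ^ 2 +
        (1 / (2 * m)) ^ 2 * Real.exp ((|W i ω| / K) ^ β) / 2) μ := fun i =>
    (((integrable_const _).add ((hint i).const_mul _)).add ((hsqi i).const_mul _)).add
      (((hei i).const_mul _).div_const _)
  have hfi : ∀ i, Integrable (fun ω => Real.exp (f i ω)) μ := fun i =>
    ((hbi i).const_mul _).mono' (Real.measurable_exp.comp_aemeasurable (hfm i)).aestronglyMeasurable
      (ae_of_all _ fun ω => by
        rw [Real.norm_eq_abs, abs_of_pos (Real.exp_pos _)]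
        exact hpt i ω)
  have hfb : ∀ i, ∫ ω, Real.exp (f i ω) ∂μ
      ≤ Real.exp (3 / 2 * l ^ 2 * Γ + (1 / (2 * m)) ^ 2) := by
    intro i
    have h1 : ∫ ω, (1 + l * W i ω + 3 / 2 * l ^ 2 * W i ω ^ 2 +
        (1 / (2 * m)) ^ 2 * Real.exp ((|W i ω| / K) ^ β) / 2) ∂μ =
        1 + l * ∫ ω, W i ω ∂μ + 3 / 2 * l ^ 2 * ∫ ω, W i ω ^ 2 ∂μ +
        (1 / (2 * m)) ^ 2 * (∫ ω, Real.exp ((|W i ω| / K) ^ β) ∂μ) / 2 := by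
      have i1 := (integrable_const (μ := μ) (1 : ℝ))
      have i2 := (hint i).const_mul l
      have i3 := (hsqi i).const_mul (3 / 2 * l ^ 2)
      have i4 := ((hei i).const_mul ((1 / (2 * m)) ^ 2)).div_const 2
      have e1 := integral_add ((i1.add i2).add i3) i4
      have e2 := integral_add (i1.add i2) i3
      have e3 := integral_add i1 i2
      simp only [Pi.add_apply] at e1 e2 e3
      rw [e1, e2, e3, integral_const_mul, integral_const_mul, integral_div, integral_const_mul]
      simp
    have h2 := integral_mono (hfi i) ((hbi i).const_mul _) (hpt i)
    rw [integral_const_mul, h1] at h2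
    refine h2.trans ?_
    set w := ∫ ω, W i ω ∂μ
    have h3 : 1 + l * w + 3 / 2 * l ^ 2 * ∫ ω, W i ω ^ 2 ∂μ +
        (1 / (2 * m)) ^ 2 * (∫ ω, Real.exp ((|W i ω| / K) ^ β) ∂μ) / 2
        ≤ Real.exp (l * w + (3 / 2 * l ^ 2 * Γ + (1 / (2 * m)) ^ 2)) := by
      refine le_trans ?_ (Real.add_one_le_exp _)
      have a1 : 3 / 2 * l ^ 2 * ∫ ω, W i ω ^ 2 ∂μ ≤ 3 / 2 * l ^ 2 * Γ := by
        gcongr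
        exact hsq i
      have a2 : (1 / (2 * m)) ^ 2 * (∫ ω, Real.exp ((|W i ω| / K) ^ β) ∂μ)
          ≤ (1 / (2 * m)) ^ 2 * 2 := by
        gcongr
        exact he i
      linarith
    calc _ ≤ Real.exp (-(l * w)) * Real.exp (l * w + (3 / 2 * l ^ 2 * Γ + (1 / (2 * m)) ^ 2)) := by
          gcongr
      _ = _ := by rw [← Real.exp_add]; congr 1; ring
  refine (iIndepFun.measureReal_le_sum_le hfind hfm hfi hfb (4 * t)).trans ?_
  rw [← hmdef]
  gcongr
  have h4 : m * (1 / (2 * m)) ^ 2 ≤ 1 / 4 := by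
    have : m * (1 / (2 * m)) ^ 2 = 1 / 4 * (1 / m) := by field_simp; norm_num
    rw [this]
    have : 1 / m ≤ 1 := by rw [div_le_one (by linarith)]; exact hm1
    linarith
  have h5 : m * (3 / 2 * l ^ 2 * Γ) = 3 / 2 * t := by rw [← hl]; ring
  rw [mul_add, h5]
  linarith

theorem measureReal_tail_sum_le [Nonempty ι] {W : ι → Ω → ℝ} (hind : iIndepFun W μ)
    (hm : ∀ i, AEMeasurable (W i) μ) {K β s t M Λ : ℝ} (ht : Real.log 2 ≤ t) (hK : 0 < K)
    (hβ : 0 < β)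
    (hΛ : Real.exp (-(Λ / 2)) = 1 / (2 * Fintype.card ι))
    (hMΛ : ∀ w : ℝ, M < |w| → K ≤ |w| ∧ Λ ≤ (|w| / K) ^ β)
    (hei : ∀ i, Integrable (fun ω => Real.exp ((|W i ω| / K) ^ β)) μ)
    (he : ∀ i, ∫ ω, Real.exp ((|W i ω| / K) ^ β) ∂μ ≤ 2)
    (hs : 0 ≤ s) (hst : 8 * t ≤ (s / K) ^ min β 1) :
    μ.real {ω | s ≤ ∑ i, (if |W i ω| ≤ M then 0 else |W i ω|)} ≤ Real.exp (-t) := by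
  have : IsProbabilityMeasure μ := hind.isProbabilityMeasure
  set m : ℝ := (Fintype.card ι : ℝ) with hmdef
  have hm1 : 1 ≤ m := by
    rw [hmdef]; exact_mod_cast Fintype.card_pos
  have ht0 : 0.69 ≤ t := by linarith [Real.log_two_gt_d9]
  have hq : 0 < min β 1 := lt_min hβ one_pos
  set g : ℝ → ℝ := fun w => if |w| ≤ M then 0 else |w| with hg
  have hg0 : ∀ w, 0 ≤ g w := fun w => by
    simp only [hg]; split_ifs <;> positivity
  have hgm : Measurable g :=
    Measurable.ite (measurableSet_le (by fun_prop) (by fun_prop)) measurable_const (by fun_prop)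
  have hhm : Measurable fun w => (g w / K) ^ min β 1 / 2 :=
    ((hgm.div_const K).pow_const _).div_const 2
  set f : ι → Ω → ℝ := fun i ω => (g (W i ω) / K) ^ min β 1 / 2 with hf
  have hfm : ∀ i, AEMeasurable (f i) μ := fun i => hhm.comp_aemeasurable (hm i)
  have hfind : iIndepFun f μ := hind.comp (fun i w => (g w / K) ^ min β 1 / 2) (fun i => hhm)
  have hpt : ∀ i ω, Real.exp (f i ω) ≤ 1 + 1 / (2 * m) * Real.exp ((|W i ω| / K) ^ β) := by
    intro i ω
    refine (exp_half_rpow_tail_le hK (hMΛ (W i ω))).trans ?_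
    rw [hΛ]
    gcongr
    split_ifs
    · simp [Real.zero_rpow hq.ne']
    · exact zero_le_one
  have hbi : ∀ i, Integrable
      (fun ω => 1 + 1 / (2 * m) * Real.exp ((|W i ω| / K) ^ β)) μ := fun i =>
    (integrable_const _).add ((hei i).const_mul _)
  have hfi : ∀ i, Integrable (fun ω => Real.exp (f i ω)) μ := fun i =>
    (hbi i).mono' (Real.measurable_exp.comp_aemeasurable (hfm i)).aestronglyMeasurable
      (ae_of_all _ fun ω => by
        rw [Real.norm_eq_abs, abs_of_pos (Real.exp_pos _)]
        exact hpt i ω)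
  have hfb : ∀ i, ∫ ω, Real.exp (f i ω) ∂μ ≤ Real.exp (1 / m) := by
    intro i
    refine (integral_mono (hfi i) (hbi i) (hpt i)).trans ?_
    rw [integral_add (integrable_const _) ((hei i).const_mul _), integral_const_mul]
    simp only [integral_const, probReal_univ, smul_eq_mul, mul_one]
    have : 1 / (2 * m) * ∫ ω, Real.exp ((|W i ω| / K) ^ β) ∂μ ≤ 1 / (2 * m) * 2 := by
      gcongr
      exact he i
    have e : 1 / (2 * m) * 2 = 1 / m := by field_simp
    linarith [Real.add_one_le_exp (1 / m)]
  have hsub : {ω | s ≤ ∑ i, g (W i ω)} ⊆ {ω | 4 * t ≤ ∑ i, f i ω} := by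
    intro ω hω
    have h1 : (s / K) ^ min β 1 ≤ (∑ i, g (W i ω) / K) ^ min β 1 := by
      rw [← Finset.sum_div]
      gcongr
      exact hω
    have h2 := Real.rpow_sum_le_sum_rpow Finset.univ
      (fun i => div_nonneg (hg0 (W i ω)) hK.le) hq (min_le_right β 1)
    simp only [Set.mem_ofPred_eq, hf, ← Finset.sum_div]
    linarith
  refine (measureReal_mono hsub).trans ?_
  refine (iIndepFun.measureReal_le_sum_le hfind hfm hfi hfb (4 * t)).trans ?_
  rw [← hmdef]
  gcongr
  have : m * (1 / m) = 1 := by field_simp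
  rw [this]
  linarith

/-- A Bernstein-type inequality for sums of independent sub-Weibull variables. -/
theorem measureReal_abs_sum_sub_integral_le [Nonempty ι] {W : ι → Ω → ℝ} (hind : iIndepFun W μ)
    (hm : ∀ i, AEMeasurable (W i) μ) {K β Γ t : ℝ} (ht : Real.log 2 ≤ t) (hΓ : 0 < Γ)
    (hK : 0 < K) (hβ : 0 < β)
    (hsqi : ∀ i, Integrable (fun ω => W i ω ^ 2) μ) (hsq : ∀ i, ∫ ω, W i ω ^ 2 ∂μ ≤ Γ)
    (hei : ∀ i, Integrable (fun ω => Real.exp ((|W i ω| / K) ^ β)) μ)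
    (he : ∀ i, ∫ ω, Real.exp ((|W i ω| / K) ^ β) ∂μ ≤ 2)
    (hMt : K * (2 * Real.log (2 * Fintype.card ι)) ^ (1 / β) * √t ≤ √(Γ * Fintype.card ι))
    (hst : 8 * t ≤ (√(Γ * Fintype.card ι * t) / K) ^ min β 1) :
    μ.real {ω | 8 * √(Γ * Fintype.card ι * t) ≤ |∑ i, (W i ω - ∫ ω, W i ω ∂μ)|}
      ≤ 3 * Real.exp (-t) := by
  have : IsProbabilityMeasure μ := hind.isProbabilityMeasure
  set m : ℝ := (Fintype.card ι : ℝ) with hmdef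
  have hm1 : 1 ≤ m := by
    rw [hmdef]; exact_mod_cast Fintype.card_pos
  have ht0 : 0.69 ≤ t := by linarith [Real.log_two_gt_d9]
  set Λ := 2 * Real.log (2 * m) with hΛdef
  have hΛ1 : 1 ≤ Λ := by
    have : Real.log 2 ≤ Real.log (2 * m) := Real.log_le_log (by norm_num) (by linarith)
    linarith [Real.log_two_gt_d9]
  have hΛ : Real.exp (-(Λ / 2)) = 1 / (2 * m) := by
    rw [hΛdef, mul_div_cancel_left₀ _ (by norm_num), Real.exp_neg, Real.exp_log (by linarith),
      one_div]
  set M := K * Λ ^ (1 / β) with hMdef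
  have hKM : K ≤ M := by
    have := Real.one_le_rpow hΛ1 (by positivity : 0 ≤ 1 / β)
    rw [hMdef]
    nlinarith
  have hMΛ : ∀ w : ℝ, M < |w| → K ≤ |w| ∧ Λ ≤ (|w| / K) ^ β := by
    intro w hw
    refine ⟨hKM.trans hw.le, ?_⟩
    have h1 : Λ ^ (1 / β) ≤ |w| / K := by
      rw [le_div_iff₀ hK]
      linarith
    calc Λ = (Λ ^ (1 / β)) ^ β := by
          rw [← Real.rpow_mul (by linarith), one_div_mul_cancel hβ.ne', Real.rpow_one]
      _ ≤ _ := by gcongr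
  have hint : ∀ i, Integrable (W i) μ := fun i =>
    ((memLp_two_iff_integrable_sq (hm i).aestronglyMeasurable).2 (hsqi i)).integrable one_le_two
  set s := √(Γ * m * t) with hs
  have hspos : 0 < s := by positivity
  have hs2 : s ^ 2 = Γ * m * t := Real.sq_sqrt (by positivity)
  have hl : (t / s) ^ 2 * (Γ * m) = t := by
    rw [div_pow, hs2]; field_simp
  have b1 := measureReal_truncated_sum_le hind hm ht hΓ hΛ hMΛ hint hsqi hsq hei
    he hMt hl
  have b2 := measureReal_truncated_sum_le hind hm ht hΓ hΛ hMΛ hint hsqi hsq hei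
    he hMt (l := -(t / s)) (by rw [neg_sq]; exact hl)
  have b3 := measureReal_tail_sum_le hind hm ht hK hβ hΛ hMΛ hei he hspos.le hst
  have hsub : {ω | 8 * s ≤ |∑ i, (W i ω - ∫ ω, W i ω ∂μ)|} ⊆
      ({ω | 4 * t ≤ ∑ i, t / s * ((if |W i ω| ≤ M then W i ω else 0) - ∫ ω, W i ω ∂μ)} ∪
      {ω | 4 * t ≤ ∑ i, -(t / s) * ((if |W i ω| ≤ M then W i ω else 0) - ∫ ω, W i ω ∂μ)}) ∪
      {ω | s ≤ ∑ i, (if |W i ω| ≤ M then 0 else |W i ω|)} := by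
    intro ω hω
    simp only [Set.mem_ofPred_eq, Set.mem_union] at hω ⊢
    by_contra! hcon
    obtain ⟨⟨c1, c2⟩, c3⟩ := hcon
    rw [← Finset.mul_sum] at c1 c2
    set Y := ∑ i, ((if |W i ω| ≤ M then W i ω else 0) - ∫ ω, W i ω ∂μ) with hY
    have e1 : ∑ i, (W i ω - ∫ ω, W i ω ∂μ) = Y + ∑ i, (if |W i ω| ≤ M then 0 else W i ω) := by
      rw [hY, ← Finset.sum_add_distrib]
      refine Finset.sum_congr rfl fun i _ => ?_
      split_ifs <;> ring
    have e2 : |∑ i, (if |W i ω| ≤ M then 0 else W i ω)|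
        ≤ ∑ i, (if |W i ω| ≤ M then 0 else |W i ω|) := by
      refine (Finset.abs_sum_le_sum_abs _ _).trans (le_of_eq ?_)
      refine Finset.sum_congr rfl fun i _ => ?_
      split_ifs <;> simp
    have d1 : Y < 4 * s := by
      rw [div_mul_eq_mul_div, div_lt_iff₀ hspos] at c1
      nlinarith
    have d2 : -Y < 4 * s := by
      rw [neg_mul, div_mul_eq_mul_div, ← neg_div, div_lt_iff₀ hspos] at c2
      nlinarith
    have d3 : |Y| < 4 * s := abs_lt.2 ⟨by linarith, d1⟩
    rw [e1] at hω
    linarith [abs_add_le Y (∑ i, (if |W i ω| ≤ M then 0 else W i ω))]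
  refine (measureReal_mono hsub).trans ?_
  refine (measureReal_union_le _ _).trans ?_
  have := measureReal_union_le (μ := μ)
    {ω | 4 * t ≤ ∑ i, t / s * ((if |W i ω| ≤ M then W i ω else 0) - ∫ ω, W i ω ∂μ)}
    {ω | 4 * t ≤ ∑ i, -(t / s) * ((if |W i ω| ≤ M then W i ω else 0) - ∫ ω, W i ω ∂μ)}
  linarith

end Concentration

/-- A bound on the Orlicz norm gives an exponential moment at every larger scale. -/
theorem integrable_exp_of_orliczNorm_le {E : Type*} [MeasurableSpace E] {ν : Measure E}
    [IsProbabilityMeasure ν] {α κ κ' : ℝ} (hα : 0 < α) (hκ' : 0 < κ') (hκ : κ < κ') {Z : E → ℝ}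
    (hZ : Measurable Z) (h : orliczNorm α Z ν ≤ ENNReal.ofReal κ) :
    Integrable (fun x => Real.exp ((|Z x| / κ') ^ α)) ν ∧
      ∫ x, Real.exp ((|Z x| / κ') ^ α) ∂ν ≤ 2 := by
  have h1 : orliczNorm α Z ν < ENNReal.ofReal κ' :=
    h.trans_lt ((ENNReal.ofReal_lt_ofReal_iff hκ').2 hκ)
  simp only [orliczNorm, iInf_lt_iff] at h1
  obtain ⟨η, hη, hle, hlt⟩ := h1
  rw [ENNReal.ofReal_lt_ofReal_iff hκ'] at hlt
  set F : E → ℝ := fun x => Real.exp ((|Z x| / η) ^ α) - 1 with hF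
  have hF0 : ∀ x, 0 ≤ F x := fun x => by
    have : 0 ≤ (|Z x| / η) ^ α := by positivity
    simp only [hF]
    linarith [Real.one_le_exp this]
  have hFm : Measurable F := by
    simp only [hF]
    exact ((((measurable_norm.comp hZ).div_const η).pow_const α).exp).sub_const 1
  have hFi : Integrable F ν := by
    refine ⟨hFm.aestronglyMeasurable, ?_⟩
    rw [hasFiniteIntegral_iff_ofReal (ae_of_all _ hF0)]
    exact hle.trans_lt ENNReal.one_lt_top
  have hF1 : ∫ x, F x ∂ν ≤ 1 := by
    rw [integral_eq_lintegral_of_nonneg_ae (ae_of_all _ hF0) hFm.aestronglyMeasurable]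
    exact ENNReal.toReal_le_of_le_ofReal zero_le_one (by simpa using hle)
  have hpt : ∀ x, Real.exp ((|Z x| / κ') ^ α) ≤ F x + 1 := fun x => by
    simp only [hF, sub_add_cancel]
    gcongr
  have hb : Integrable (fun x => F x + 1) ν := hFi.add (integrable_const _)
  have hm : Measurable fun x => Real.exp ((|Z x| / κ') ^ α) :=
    (((measurable_norm.comp hZ).div_const κ').pow_const α).exp
  have hi : Integrable (fun x => Real.exp ((|Z x| / κ') ^ α)) ν :=
    hb.mono' hm.aestronglyMeasurable (ae_of_all _ fun x => by
      rw [Real.norm_eq_abs, abs_of_pos (Real.exp_pos _)]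
      exact hpt x)
  refine ⟨hi, (integral_mono hi hb hpt).trans ?_⟩
  rw [integral_add hFi (integrable_const _)]
  simp only [integral_const, probReal_univ, smul_eq_mul, mul_one]
  linarith

/-- Powers are dominated by stretched exponentials. -/
theorem exists_pow_le_mul_exp_rpow {α : ℝ} (hα : 0 < α) (k : ℕ) :
    ∃ c : ℝ, ∀ y : ℝ, 0 ≤ y → y ^ k ≤ c * Real.exp (y ^ α) := by
  refine ⟨(⌈k / α⌉₊.factorial : ℝ), fun y hy => ?_⟩
  have hf : (1 : ℝ) ≤ (⌈k / α⌉₊.factorial : ℝ) := by exact_mod_cast Nat.factorial_pos _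
  rcases le_total y 1 with h | h
  · have h1 : y ^ k ≤ 1 := pow_le_one₀ hy h
    have h2 : 1 ≤ Real.exp (y ^ α) := Real.one_le_exp (by positivity)
    nlinarith
  · have h1 : 1 ≤ y ^ α := Real.one_le_rpow h hα.le
    have h2 := Real.pow_div_factorial_le_exp (y ^ α) (by positivity) ⌈k / α⌉₊
    rw [div_le_iff₀ (by positivity)] at h2
    calc y ^ k = (y ^ α) ^ (k / α) := by
          rw [← Real.rpow_mul hy, mul_div_cancel₀ _ hα.ne', Real.rpow_natCast]
      _ ≤ (y ^ α) ^ (⌈k / α⌉₊ : ℝ) := Real.rpow_le_rpow_of_exponent_le h1 (Nat.le_ceil _)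
      _ = (y ^ α) ^ ⌈k / α⌉₊ := Real.rpow_natCast _ _
      _ ≤ _ := by linarith

theorem integrable_pow_of_integrable_exp_rpow {E : Type*} [MeasurableSpace E] {ν : Measure E}
    {α κ : ℝ} (hα : 0 < α) (hκ : 0 < κ) {Z : E → ℝ} (hZ : AEMeasurable Z ν)
    (h : Integrable (fun x => Real.exp ((|Z x| / κ) ^ α)) ν) (k : ℕ) :
    Integrable (fun x => Z x ^ k) ν := by
  obtain ⟨c, hc⟩ := exists_pow_le_mul_exp_rpow hα k
  refine ((h.const_mul c).const_mul (κ ^ k)).mono' (hZ.pow_const k).aestronglyMeasurable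
    (ae_of_all _ fun x => ?_)
  have := hc (|Z x| / κ) (by positivity)
  rw [div_pow, div_le_iff₀ (by positivity)] at this
  rw [norm_pow, Real.norm_eq_abs]
  linarith

theorem exp_rpow_mul_le {α κ x y : ℝ} (hκ : 0 < κ) :
    Real.exp ((|x * y| / κ ^ 2) ^ (α / 2)) ≤
      (Real.exp ((|x| / κ) ^ α) + Real.exp ((|y| / κ) ^ α)) / 2 := by
  have e1 : ∀ z : ℝ, (|z| / κ) ^ α = ((|z| / κ) ^ (α / 2)) ^ 2 := fun z => by
    rw [← Real.rpow_natCast, ← Real.rpow_mul (by positivity)]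
    norm_num
  have e2 : (|x * y| / κ ^ 2) ^ (α / 2) = (|x| / κ) ^ (α / 2) * (|y| / κ) ^ (α / 2) := by
    rw [← Real.mul_rpow (by positivity) (by positivity), abs_mul, sq, mul_div_mul_comm]
  rw [e1, e1, e2]
  set a := (|x| / κ) ^ (α / 2)
  set b := (|y| / κ) ^ (α / 2)
  have h1 : Real.exp (a * b) ≤ Real.exp (a ^ 2 / 2) * Real.exp (b ^ 2 / 2) := by
    rw [← Real.exp_add]
    gcongr
    nlinarith [sq_nonneg (a - b)]
  have h2 : ∀ z : ℝ, Real.exp z = Real.exp (z / 2) ^ 2 := fun z => by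
    rw [← Real.exp_nat_mul]; congr 1; push_cast; ring
  rw [h2 (a ^ 2), h2 (b ^ 2)]
  nlinarith [sq_nonneg (Real.exp (a ^ 2 / 2) - Real.exp (b ^ 2 / 2))]

/-- A strict upper bound that is continuous in the scale leaves room for a larger scale. -/
theorem exists_gt_scale {A κ N : ℝ} (h : A * κ ^ 4 < N) :
    ∃ κ', 0 < κ' ∧ κ < κ' ∧ A * κ' ^ 4 < N := by
  have hc : ContinuousAt (fun x : ℝ => A * x ^ 4) |κ| := by fun_prop
  have h' : A * |κ| ^ 4 < N := by rwa [show |κ| ^ 4 = κ ^ 4 from Even.pow_abs (by decide) κ]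
  have hev := (hc.eventually (gt_mem_nhds h')).filter_mono (nhdsWithin_le_nhds (s := Set.Ioi |κ|))
  obtain ⟨κ', h1, h2⟩ := (hev.and self_mem_nhdsWithin).exists
  exact ⟨κ', (abs_nonneg κ).trans_lt h2, (le_abs_self κ).trans_lt h2, h1⟩

/-- The constant in the sample size condition. -/
noncomputable def sampleConstant (α : ℝ) : ℝ := 8 ^ (1 / min (α / 2) 1) + 2 ^ (1 / (α / 2))

/-- Consequences of the sample size condition for the truncation level and the tail part. -/
theorem truncation_bounds {α K Γ : ℝ} {m p : ℕ} (hα : 0 < α) (hK : 0 < K)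
    (hm : 0 < m) (hp : 0 < p)
    (h : 4 * sampleConstant α ^ 2 * K ^ 2 * Real.log (2 * (2 * m)) ^ (4 / α) *
      (3 * Real.log (p * (2 * m))) ^ (4 / min α 2 - 1) ≤ Γ * (2 * m)) :
    Real.log 2 ≤ Real.log (p * (2 * m)) + 2 * Real.log p ∧
    K * (2 * Real.log (2 * m)) ^ (1 / (α / 2)) * √(Real.log (p * (2 * m)) + 2 * Real.log p)
        ≤ √(Γ * m) ∧
    8 * (Real.log (p * (2 * m)) + 2 * Real.log p)
      ≤ (√(Γ * m * (Real.log (p * (2 * m)) + 2 * Real.log p)) / K) ^ min (α / 2) 1 := by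
  have hm1 : (1 : ℝ) ≤ m := by exact_mod_cast hm
  have hp1 : (1 : ℝ) ≤ p := by exact_mod_cast hp
  have hlp : 0 ≤ Real.log p := Real.log_nonneg hp1
  have hln : Real.log 2 ≤ Real.log (2 * m) := Real.log_le_log (by norm_num) (by linarith)
  have hL : Real.log (p * (2 * m)) = Real.log p + Real.log (2 * m) :=
    Real.log_mul (by positivity) (by positivity)
  have hl : Real.log (2 * (2 * m)) = Real.log 2 + Real.log (2 * m) :=
    Real.log_mul (by positivity) (by positivity)
  have h2 := Real.log_two_gt_d9
  set L := Real.log (p * (2 * m))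
  set ℓ := Real.log (2 * (2 * (m : ℝ)))
  set t := L + 2 * Real.log p with ht
  have hℓ1 : 1 ≤ ℓ := by linarith
  have htL : t ≤ 3 * L := by linarith
  have ht0 : 0.69 ≤ t := by linarith
  have hL1 : 1 ≤ 3 * L := by linarith
  set q := min (α / 2) 1 with hq
  have hq0 : 0 < q := lt_min (by positivity) one_pos
  have hq1 : q ≤ 1 := min_le_right _ _
  have hmin : min α 2 = 2 * q := by
    rw [hq, mul_min_of_nonneg _ _ (by norm_num : (0 : ℝ) ≤ 2)]
    congr 1
    · ring
    · norm_num
  have hexp : 4 / min α 2 - 1 = 2 / q - 1 := by rw [hmin]; congr 1; field_simp; norm_num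
  rw [hexp] at h
  have hq2 : 1 ≤ 2 / q - 1 := by
    have : 2 ≤ 2 / q := by rw [le_div_iff₀ hq0]; linarith
    linarith
  set c1 : ℝ := 8 ^ (1 / q) with hc1
  set c2 : ℝ := 2 ^ (1 / (α / 2)) with hc2
  have hc1p : 0 < c1 := by positivity
  have hc2p : 0 < c2 := by positivity
  have hC : sampleConstant α = c1 + c2 := rfl
  set P := (3 * L) ^ (2 / q - 1) with hP
  set A := ℓ ^ (4 / α) with hA
  have hA1 : 1 ≤ A := Real.one_le_rpow hℓ1 (by positivity)
  have hP0 : 0 < P := by positivity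
  have hPt : t ≤ P := by
    calc t ≤ 3 * L := htL
      _ = (3 * L) ^ (1 : ℝ) := (Real.rpow_one _).symm
      _ ≤ P := Real.rpow_le_rpow_of_exponent_le hL1 hq2
  have hPt2 : t ^ (2 / q - 1) ≤ P := by
    rw [hP]
    gcongr
  rw [hC] at h
  refine ⟨by linarith, ?_, ?_⟩
  · apply Real.le_sqrt_of_sq_le
    have e1 : (2 * Real.log (2 * m)) ^ (1 / (α / 2)) ≤ c2 * ℓ ^ (1 / (α / 2)) := by
      rw [hc2, ← Real.mul_rpow (by norm_num) (by linarith)]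
      have : 0 ≤ 1 / (α / 2) := by positivity
      gcongr <;> linarith
    have e2 : (ℓ ^ (1 / (α / 2))) ^ 2 = A := by
      rw [← Real.rpow_natCast, ← Real.rpow_mul (by linarith), hA]
      congr 1
      field_simp
      norm_num
    rw [mul_pow, Real.sq_sqrt (by linarith)]
    have e0 : 0 ≤ (2 * Real.log (2 * m)) ^ (1 / (α / 2)) :=
      Real.rpow_nonneg (by linarith) _
    calc (K * (2 * Real.log (2 * m)) ^ (1 / (α / 2))) ^ 2 * t
        ≤ (K * (c2 * ℓ ^ (1 / (α / 2)))) ^ 2 * P := by gcongr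
      _ = c2 ^ 2 * K ^ 2 * A * P := by rw [← e2]; ring
      _ ≤ (c1 + c2) ^ 2 * K ^ 2 * A * P := by gcongr; linarith
      _ ≤ Γ * m := by
        have : 0 ≤ (c1 + c2) ^ 2 * K ^ 2 * A * P := by positivity
        linarith
  · have key : (8 * t) ^ (1 / q) * K ≤ √(Γ * m * t) := by
      apply Real.le_sqrt_of_sq_le
      have e1 : (8 * t) ^ (1 / q) = c1 * t ^ (1 / q) :=
        Real.mul_rpow (by norm_num) (by linarith)
      have e2 : (t ^ (1 / q)) ^ 2 = t ^ (2 / q - 1) * t := by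
        nth_rewrite 3 [← Real.rpow_one t]
        rw [← Real.rpow_add (by linarith), ← Real.rpow_natCast, ← Real.rpow_mul (by linarith)]
        congr 1
        push_cast
        ring
      calc ((8 * t) ^ (1 / q) * K) ^ 2 = c1 ^ 2 * K ^ 2 * 1 * t ^ (2 / q - 1) * t := by
            rw [e1, mul_pow, mul_pow, e2]; ring
        _ ≤ (c1 + c2) ^ 2 * K ^ 2 * A * P * t := by gcongr; linarith
        _ ≤ Γ * m * t := by
          refine mul_le_mul_of_nonneg_right ?_ (by linarith)
          have : 0 ≤ (c1 + c2) ^ 2 * K ^ 2 * A * P := by positivity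
          linarith
    calc 8 * t = ((8 * t) ^ (1 / q)) ^ q := by
          rw [← Real.rpow_mul (by linarith), one_div_mul_cancel hq0.ne', Real.rpow_one]
      _ ≤ _ := by
        gcongr
        rwa [le_div_iff₀ hK]

/-- Pairs of i.i.d. variables along disjoint indices are independent. -/
theorem iIndepFun.prodMk_of_disjoint {ι κ Ω E : Type*} [Finite ι] [MeasurableSpace Ω]
    [MeasurableSpace E] {μ : Measure Ω} {ν : Measure E} {f : κ → Ω → E}
    (hind : iIndepFun f μ) (hlaw : ∀ k, HasLaw (f k) ν μ) {g₁ g₂ : ι → κ}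
    (h₁ : g₁.Injective) (h₂ : g₂.Injective) (h₁₂ : ∀ i j, g₁ i ≠ g₂ j) :
    iIndepFun (fun i ω => (f (g₁ i) ω, f (g₂ i) ω)) μ := by
  classical
  have := Fintype.ofFinite ι
  have : IsProbabilityMeasure μ := hind.isProbabilityMeasure
  rcases isEmpty_or_nonempty κ with hκ | ⟨⟨k⟩⟩
  · have : IsEmpty ι := ⟨fun i => hκ.false (g₁ i)⟩
    exact iIndepFun.of_subsingleton
  have : IsProbabilityMeasure ν := (hlaw k).isProbabilityMeasure_iff.1 inferInstance
  have hpair : ∀ i, HasLaw (fun ω => (f (g₁ i) ω, f (g₂ i) ω)) (ν.prod ν) μ := fun i =>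
    (hind.indepFun (h₁₂ i i)).hasLaw_prod (hlaw _) (hlaw _)
  rw [iIndepFun_iff_hasLaw_pi_pi hpair]
  have hA := (hind.precomp h₁).hasLaw_pi (fun i => hlaw (g₁ i))
  have hB := (hind.precomp h₂).hasLaw_pi (fun i => hlaw (g₂ i))
  have hdisj : Disjoint (Finset.univ.image g₁) (Finset.univ.image g₂) := by
    rw [Finset.disjoint_left]
    intro a ha hb
    obtain ⟨i, _, rfl⟩ := Finset.mem_image.1 ha
    obtain ⟨j, _, hj⟩ := Finset.mem_image.1 hb
    exact h₁₂ i j hj.symm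
  have hST := hind.indepFun_finset₀ _ _ hdisj (fun k => (hlaw k).aemeasurable)
  have hAB : IndepFun (fun ω i => f (g₁ i) ω) (fun ω i => f (g₂ i) ω) μ :=
    hST.comp (φ := fun (x : ↥(Finset.univ.image g₁) → E) (i : ι) =>
        x ⟨g₁ i, Finset.mem_image_of_mem _ (Finset.mem_univ i)⟩)
      (ψ := fun (x : ↥(Finset.univ.image g₂) → E) (i : ι) =>
        x ⟨g₂ i, Finset.mem_image_of_mem _ (Finset.mem_univ i)⟩)
      (by fun_prop) (by fun_prop)
  have hlawAB := hAB.hasLaw_prod hA hB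
  have hmp := (measurePreserving_arrowProdEquivProdArrow E E ι (fun _ => ν) (fun _ => ν)).symm
  exact hmp.fun_comp_hasLaw hlawAB

section Structure

theorem clusterPermMatrices_subset {n c : ℕ} {L : Fin c → Finset (Fin n)}
    (hL : IsEqualPartition L) : clusterPermMatrices L ⊆ crossHalfPermMatrices (Fin n) := by
  classical
  rintro G ⟨hoff, hblk⟩
  obtain ⟨hdisj, hcov, -⟩ := hL
  choose k hk using hcov
  choose g N₁ N₂ hd hu hc h12 h21 hG using hblk
  have huniq : ∀ {a b i}, i ∈ L a → i ∈ L b → a = b := by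
    intro a b i ha hb
    by_contra hab
    exact Finset.disjoint_left.1 (hdisj hab) ha hb
  have hent : ∀ a i j (hi : i ∈ L a) (hj : j ∈ L a),
      G i j = if ((g a ⟨i, hi⟩ : L a) : Fin n) = j then 1 else 0 := by
    intro a i j hi hj
    have := congrFun (congrFun (hG a) ⟨i, hi⟩) ⟨j, hj⟩
    simp only [submatrix_apply] at this
    rw [this]
    simp [Equiv.Perm.permMatrix, PEquiv.toMatrix_apply, Subtype.ext_iff, eq_comm]
  set φ : Fin n → Fin n := fun i => (g (k i) ⟨i, hk i⟩ : L (k i)) with hφ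
  have hφk : ∀ i, k (φ i) = k i := fun i => huniq (hk (φ i)) (g (k i) ⟨i, hk i⟩).2
  have hinj : ∀ a b (_ : a = b) i j (hi : i ∈ L a) (hj : j ∈ L b),
      ((g a ⟨i, hi⟩ : L a) : Fin n) = (g b ⟨j, hj⟩ : L b) → i = j := by
    rintro a b rfl i j hi hj h
    have := (g a).injective (Subtype.ext h)
    simpa using this
  have htrans : ∀ (N : ∀ a, Finset (L a)) a b (_ : a = b) i (hi : i ∈ L a) (hi' : i ∈ L b),
      (⟨i, hi⟩ : L a) ∈ N a → (⟨i, hi'⟩ : L b) ∈ N b := by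
    rintro N a b rfl i hi hi' h
    exact h
  have hφinj : Function.Injective φ := fun i j h =>
    hinj _ _ (by rw [← hφk i, ← hφk j, h]) i j (hk i) (hk j) h
  set M₁ : Finset (Fin n) := Finset.univ.filter fun i => (⟨i, hk i⟩ : L (k i)) ∈ N₁ (k i)
  set M₂ : Finset (Fin n) := Finset.univ.filter fun i => (⟨i, hk i⟩ : L (k i)) ∈ N₂ (k i)
  have m12 : ∀ i ∈ M₁, φ i ∈ M₂ := by
    intro i hi
    simp only [M₁, M₂, Finset.mem_filter, Finset.mem_univ, true_and] at hi ⊢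
    exact htrans N₂ _ _ (hφk i).symm _ (g (k i) ⟨i, hk i⟩).2 _ (h12 _ _ hi)
  have m21 : ∀ i ∈ M₂, φ i ∈ M₁ := by
    intro i hi
    simp only [M₁, M₂, Finset.mem_filter, Finset.mem_univ, true_and] at hi ⊢
    exact htrans N₁ _ _ (hφk i).symm _ (g (k i) ⟨i, hk i⟩).2 _ (h21 _ _ hi)
  refine ⟨Equiv.ofBijective φ (Finite.injective_iff_bijective.1 hφinj), M₁, M₂, ?_, ?_, ?_,
    m12, m21, ?_⟩
  · rw [Finset.disjoint_left]
    intro i h1 h2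
    simp only [M₁, M₂, Finset.mem_filter, Finset.mem_univ, true_and] at h1 h2
    exact Finset.disjoint_left.1 (hd _) h1 h2
  · ext i
    have := Finset.mem_univ (⟨i, hk i⟩ : L (k i))
    rw [← hu, Finset.mem_union] at this
    simpa [M₁, M₂] using this
  · exact le_antisymm (Finset.card_le_card_of_injOn φ m12 hφinj.injOn)
      (Finset.card_le_card_of_injOn φ m21 hφinj.injOn)
  · ext i j
    simp only [Equiv.Perm.permMatrix, PEquiv.toMatrix_apply, Equiv.toPEquiv_apply,
      Option.mem_some_iff, Equiv.ofBijective_apply]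
    by_cases hij : k i = k j
    · rw [hent (k i) i j (hk i) (hij ▸ hk j)]
    · rw [hoff _ _ hij i (hk i) j (hk j), if_neg]
      intro h
      exact hij (by rw [← h, hφk])

variable {n p : ℕ}

theorem transpose_mul_permMatrix_mul_apply (X : Matrix (Fin n) (Fin p) ℝ)
    (g : Equiv.Perm (Fin n)) (u v : Fin p) :
    (Xᵀ * g.permMatrix ℝ * X) u v = ∑ i, X i u * X (g i) v := by
  rw [Matrix.mul_assoc, Matrix.mul_apply]
  refine Finset.sum_congr rfl fun i _ => ?_
  rw [transpose_apply, Matrix.mul_apply]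
  simp [Equiv.Perm.permMatrix, PEquiv.toMatrix_apply]

theorem transpose_mul_diagonal_mul_apply (X : Matrix (Fin n) (Fin p) ℝ)
    (s : Fin n → ℝ) (u v : Fin p) :
    (Xᵀ * diagonal s * X) u v = ∑ i, s i * (X i u * X i v) := by
  rw [Matrix.mul_apply]
  refine Finset.sum_congr rfl fun i _ => ?_
  rw [Matrix.mul_diagonal, transpose_apply]
  ring

theorem exists_le_abs_of_le_maxAbsEntry [NeZero p] {M : Matrix (Fin p) (Fin p) ℝ} {x : ℝ}
    (h : x ≤ maxAbsEntry M) : ∃ u v, x ≤ |M u v| := by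
  obtain ⟨u, hu⟩ := exists_eq_ciSup_of_finite (f := fun u => ⨆ v, |M u v|)
  obtain ⟨v, hv⟩ := exists_eq_ciSup_of_finite (f := fun v => |M u v|)
  exact ⟨u, v, by rw [hv, hu]; exact h⟩

end Structure

theorem HasLaw.integrable_fun_comp {Ω E : Type*} [MeasurableSpace Ω] [MeasurableSpace E]
    {μ : Measure Ω} {ν : Measure E} {Y : Ω → E} (hY : HasLaw Y ν μ) {f : E → ℝ}
    (hf : Integrable f ν) : Integrable (fun ω => f (Y ω)) μ :=
  (show Integrable f (μ.map Y) by rwa [hY.map_eq]).comp_aemeasurable hY.aemeasurable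

theorem sq_integral_le_integral_sq {E : Type*} [MeasurableSpace E] {ν : Measure E}
    [IsProbabilityMeasure ν] {f : E → ℝ} (hf : Integrable f ν)
    (hf2 : Integrable (fun x => f x ^ 2) ν) : (∫ x, f x ∂ν) ^ 2 ≤ ∫ x, f x ^ 2 ∂ν := by
  have h := integral_nonneg (μ := ν) (f := fun x => (f x - ∫ y, f y ∂ν) ^ 2)
    (fun x => sq_nonneg _)
  set c := ∫ y, f y ∂ν with hc
  have e : ∀ x, (f x - c) ^ 2 = f x ^ 2 - 2 * c * f x + c ^ 2 := fun x => by ring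
  simp only [e] at h
  have hi : Integrable (fun x => f x ^ 2 - 2 * c * f x) ν := hf2.sub (hf.const_mul _)
  rw [integral_add hi (integrable_const _), integral_sub hf2 (hf.const_mul _), integral_const_mul, ← hc] at h
  simp only [integral_const, probReal_univ, smul_eq_mul, one_mul] at h
  linarith

theorem integral_mul_sq_le_momentGamma {p : ℕ} (a : Fin p → ℝ) (ν : Measure (Fin p → ℝ))
    (u v : Fin p) : ∫ x, (x u * x v) ^ 2 ∂ν ≤ momentGamma a ν := by
  refine le_trans ?_ ((le_max_right _ _).trans (le_max_right _ _))
  refine le_trans ?_ (le_ciSup (Set.finite_range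
    fun u => ⨆ v, ∫ x : Fin p → ℝ, (x u * x v) ^ 2 ∂ν).bddAbove u)
  exact le_ciSup (Set.finite_range fun v => ∫ x : Fin p → ℝ, (x u * x v) ^ 2 ∂ν).bddAbove v

theorem neg_log_weight {n p : ℕ} (hn : 0 < n) (hp : 0 < p) :
    Real.exp (-(Real.log (p * n) + 2 * Real.log p)) = 1 / (n * p * (p * p)) := by
  have hn' : (0 : ℝ) < n := by exact_mod_cast hn
  have hp' : (0 : ℝ) < p := by exact_mod_cast hp
  rw [Real.exp_neg, Real.exp_add, Real.exp_log (by positivity),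
    show 2 * Real.log p = Real.log p + Real.log p by ring, Real.exp_add, Real.exp_log hp', one_div]
  congr 1
  ring

namespace CovariateCondition

variable {Ω : Type*} [MeasurableSpace Ω] {μ : Measure Ω} {n p : ℕ}
  {α κ κ' : ℝ} {X : Ω → Matrix (Fin n) (Fin p) ℝ} {ν : Measure (Fin p → ℝ)}

theorem integrable_exp (h : CovariateCondition α κ X ν μ) [IsProbabilityMeasure ν] (hα : 0 < α)
    (hκ' : 0 < κ') (hκ : κ < κ') (u : Fin p) :
    Integrable (fun x : Fin p → ℝ => Real.exp ((|x u| / κ') ^ α)) ν ∧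
      ∫ x : Fin p → ℝ, Real.exp ((|x u| / κ') ^ α) ∂ν ≤ 2 :=
  integrable_exp_of_orliczNorm_le hα hκ' hκ (measurable_pi_apply u) (h.marginal_le u)

theorem integrable_pow (h : CovariateCondition α κ X ν μ) [IsProbabilityMeasure ν] (hα : 0 < α)
    (u : Fin p) (k : ℕ) : Integrable (fun x : Fin p → ℝ => x u ^ k) ν := by
  have hκ' : 0 < max κ 0 + 1 := by positivity
  have hκ : κ < max κ 0 + 1 := (le_max_left _ _).trans_lt (lt_add_one _)
  exact integrable_pow_of_integrable_exp_rpow hα hκ' (measurable_pi_apply u).aemeasurable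
    (h.integrable_exp hα hκ' hκ u).1 k

theorem sq_integral_sq_le (h : CovariateCondition α κ X ν μ) [IsProbabilityMeasure ν] (hα : 0 < α)
    (a : Fin p → ℝ) (u : Fin p) :
    (∫ x : Fin p → ℝ, x u ^ 2 ∂ν) ^ 2 ≤ momentGamma a ν := by
  have h4 : Integrable (fun x : Fin p → ℝ => (x u ^ 2) ^ 2) ν := by
    simpa only [← pow_mul] using h.integrable_pow hα u (2 * 2)
  refine (sq_integral_le_integral_sq (h.integrable_pow hα u 2) h4).trans ?_
  refine le_trans (le_of_eq ?_) (integral_mul_sq_le_momentGamma a ν u u)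
  simp only [sq]

theorem momentGamma_pos (h : CovariateCondition α κ X ν μ) [IsProbabilityMeasure ν] (hα : 0 < α)
    (a : Fin p → ℝ) (u : Fin p) : 0 < momentGamma a ν := by
  have h1 : 0 < covMatrix ν u u := h.posDef.diag_pos
  have h2 : covMatrix ν u u = ∫ x : Fin p → ℝ, x u ^ 2 ∂ν := by
    simp only [covMatrix, Matrix.of_apply, covariance, h.mean_zero, sub_zero, sq]
  rw [h2] at h1
  exact (pow_pos h1 2).trans_le (h.sq_integral_sq_le hα a u)

theorem integrable_exp_mul (h : CovariateCondition α κ X ν μ) [IsProbabilityMeasure ν]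
    (hα : 0 < α) (hκ' : 0 < κ') (hκ : κ < κ') (i j : Fin n) (u v : Fin p) :
    Integrable (fun ω => Real.exp ((|X ω i u * X ω j v| / κ' ^ 2) ^ (α / 2))) μ ∧
      ∫ ω, Real.exp ((|X ω i u * X ω j v| / κ' ^ 2) ^ (α / 2)) ∂μ ≤ 2 := by
  have hm : ∀ i u, AEMeasurable (fun ω => X ω i u) μ := fun i u =>
    (measurable_pi_apply u).comp_aemeasurable (h.hasLaw i).aemeasurable
  have hI : ∀ i u, Integrable (fun ω => Real.exp ((|X ω i u| / κ') ^ α)) μ ∧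
      ∫ ω, Real.exp ((|X ω i u| / κ') ^ α) ∂μ ≤ 2 := fun i u => by
    obtain ⟨h1, h2⟩ := h.integrable_exp hα hκ' hκ u
    refine ⟨HasLaw.integrable_fun_comp (h.hasLaw i) h1, ?_⟩
    exact ((h.hasLaw i).integral_comp h1.aestronglyMeasurable).trans_le h2
  have hb : Integrable (fun ω => (Real.exp ((|X ω i u| / κ') ^ α) +
      Real.exp ((|X ω j v| / κ') ^ α)) / 2) μ := ((hI i u).1.add (hI j v).1).div_const 2
  have hmm : AEMeasurable (fun ω => Real.exp ((|X ω i u * X ω j v| / κ' ^ 2) ^ (α / 2))) μ :=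
    (((measurable_norm.comp_aemeasurable ((hm i u).mul (hm j v))).div_const _).pow_const _).exp
  have hi := hb.mono' hmm.aestronglyMeasurable (ae_of_all _ fun ω => by
    rw [Real.norm_eq_abs, abs_of_pos (Real.exp_pos _)]
    exact exp_rpow_mul_le hκ')
  refine ⟨hi, (integral_mono hi hb fun ω => exp_rpow_mul_le hκ').trans ?_⟩
  rw [integral_div, integral_add (hI i u).1 (hI j v).1]
  linarith [(hI i u).2, (hI j v).2]

/-- Deviation of a sum of products of two entries in the same row. -/
theorem measureReal_sum_same_row_le (h : CovariateCondition α κ X ν μ) [IsProbabilityMeasure ν]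
    (hα : 0 < α) (hκ' : 0 < κ') (hκ : κ < κ') (a : Fin p → ℝ) {t : ℝ} (ht : Real.log 2 ≤ t)
    {m : ℕ} (hm : 0 < m)
    (hMt : κ' ^ 2 * (2 * Real.log (2 * m)) ^ (1 / (α / 2)) * √t ≤ √(momentGamma a ν * m))
    (hst : 8 * t ≤ (√(momentGamma a ν * m * t) / κ' ^ 2) ^ min (α / 2) 1)
    {N : Finset (Fin n)} (hN : N.card = m) (u v : Fin p) :
    μ.real {ω | 8 * √(momentGamma a ν * m * t) ≤
      |∑ i ∈ N, (X ω i u * X ω i v - ∫ x, x u * x v ∂ν)|} ≤ 3 * Real.exp (-t) := by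
  have hcard : Fintype.card N = m := by simpa using hN
  have : Nonempty N := by rw [← Fintype.card_pos_iff, hcard]; exact hm
  have hφ : Measurable fun x : Fin p → ℝ => x u * x v := by fun_prop
  have hE : ∀ i, ∫ ω, X ω i u * X ω i v ∂μ = ∫ x, x u * x v ∂ν := fun i =>
    (h.hasLaw i).integral_comp hφ.aestronglyMeasurable
  have hsqi : Integrable (fun x : Fin p → ℝ => (x u * x v) ^ 2) ν := by
    refine ((h.integrable_pow hα u 4).add (h.integrable_pow hα v 4)).mono'
      (hφ.pow_const 2).aestronglyMeasurable (ae_of_all _ fun x => ?_)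
    rw [Real.norm_eq_abs, abs_of_nonneg (sq_nonneg _), Pi.add_apply]
    nlinarith [sq_nonneg (x u ^ 2 - x v ^ 2), sq_nonneg (x u ^ 2), sq_nonneg (x v ^ 2)]
  have key := measureReal_abs_sum_sub_integral_le (μ := μ)
    (W := fun (i : N) ω => X ω i u * X ω i v)
    ((h.indep.precomp Subtype.val_injective).comp (fun _ x => x u * x v) (fun _ => hφ))
    (fun i => hφ.comp_aemeasurable (h.hasLaw i).aemeasurable) ht (h.momentGamma_pos hα a u)
    (pow_pos hκ' 2) (half_pos hα) (fun i => HasLaw.integrable_fun_comp (h.hasLaw i) hsqi)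
    (fun i => ((h.hasLaw i).integral_comp hsqi.aestronglyMeasurable).trans_le
      (integral_mul_sq_le_momentGamma a ν u v))
    (fun i => (h.integrable_exp_mul hα hκ' hκ i i u v).1)
    (fun i => (h.integrable_exp_mul hα hκ' hκ i i u v).2)
    (by rw [hcard]; exact hMt) (by rw [hcard]; exact hst)
  rw [hcard] at key
  simp only [hE] at key
  convert key using 6 with ω
  rw [← Finset.sum_coe_sort]

/-- Deviation of a sum of products of entries in disjoint pairs of rows. -/
theorem measureReal_sum_cross_rows_le (h : CovariateCondition α κ X ν μ) [IsProbabilityMeasure ν]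
    (hα : 0 < α) (hκ' : 0 < κ') (hκ : κ < κ') (a : Fin p → ℝ) {t : ℝ} (ht : Real.log 2 ≤ t)
    {m : ℕ} (hm : 0 < m)
    (hMt : κ' ^ 2 * (2 * Real.log (2 * m)) ^ (1 / (α / 2)) * √t ≤ √(momentGamma a ν * m))
    (hst : 8 * t ≤ (√(momentGamma a ν * m * t) / κ' ^ 2) ^ min (α / 2) 1)
    {N : Finset (Fin n)} (hN : N.card = m) {g : Fin n → Fin n} (hg : g.Injective)
    (hgN : ∀ i ∈ N, g i ∉ N) (u v : Fin p) :
    μ.real {ω | 8 * √(momentGamma a ν * m * t) ≤ |∑ i ∈ N, X ω i u * X ω (g i) v|}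
      ≤ 3 * Real.exp (-t) := by
  have hcard : Fintype.card N = m := by simpa using hN
  have : Nonempty N := by rw [← Fintype.card_pos_iff, hcard]; exact hm
  have hne : ∀ i j : N, (i : Fin n) ≠ g j := fun i j hij => hgN j j.2 (hij ▸ i.2)
  have hpairs := iIndepFun.prodMk_of_disjoint (f := fun i ω => X ω i) h.indep h.hasLaw
    (g₁ := fun i : N => (i : Fin n)) (g₂ := fun i : N => g i) Subtype.val_injective
    (hg.comp Subtype.val_injective) hne
  have hme : ∀ i u, AEMeasurable (fun ω => X ω i u) μ := fun i u =>
    (measurable_pi_apply u).comp_aemeasurable (h.hasLaw i).aemeasurable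
  have hind : ∀ (k l : ℕ) (i : N), IndepFun (fun ω => X ω i u ^ k) (fun ω => X ω (g i) v ^ l) μ :=
    fun k l i => (h.indep.indepFun (hne i i)).comp (φ := fun x : Fin p → ℝ => x u ^ k)
      (ψ := fun x : Fin p → ℝ => x v ^ l) (by fun_prop) (by fun_prop)
  have hE : ∀ i : N, ∫ ω, X ω i u * X ω (g i) v ∂μ = 0 := fun i => by
    have h1 := (hind 1 1 i).integral_fun_mul_eq_mul_integral
      ((hme _ _).pow_const 1).aestronglyMeasurable ((hme _ _).pow_const 1).aestronglyMeasurable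
    simp only [pow_one] at h1
    have h2 : ∫ ω, X ω i u ∂μ = 0 := by
      rw [← h.mean_zero u]
      exact (h.hasLaw i).integral_comp (measurable_pi_apply u).aestronglyMeasurable
    rw [h1, h2, zero_mul]
  have hsqm : ∀ u, Measurable fun x : Fin p → ℝ => x u ^ 2 := fun u => by fun_prop
  have hpow : ∀ i u, ∫ ω, X ω i u ^ 2 ∂μ = ∫ x : Fin p → ℝ, x u ^ 2 ∂ν := fun i u =>
    (h.hasLaw i).integral_comp (hsqm u).aestronglyMeasurable
  have hpowi : ∀ i u, Integrable (fun ω => X ω i u ^ 2) μ := fun i u =>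
    HasLaw.integrable_fun_comp (h.hasLaw i) (h.integrable_pow hα u 2)
  have hsqi : ∀ i : N, Integrable (fun ω => (X ω i u * X ω (g i) v) ^ 2) μ := fun i => by
    simp only [mul_pow]
    exact (hind 2 2 i).integrable_mul (hpowi _ _) (hpowi _ _)
  have hsq : ∀ i : N, ∫ ω, (X ω i u * X ω (g i) v) ^ 2 ∂μ ≤ momentGamma a ν := fun i => by
    simp only [mul_pow]
    rw [(hind 2 2 i).integral_fun_mul_eq_mul_integral (hpowi _ _).aestronglyMeasurable
      (hpowi _ _).aestronglyMeasurable, hpow, hpow]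
    have h1 := h.sq_integral_sq_le hα a u
    have h2 := h.sq_integral_sq_le hα a v
    nlinarith [sq_nonneg ((∫ x : Fin p → ℝ, x u ^ 2 ∂ν) - ∫ x : Fin p → ℝ, x v ^ 2 ∂ν)]
  have key := measureReal_abs_sum_sub_integral_le (μ := μ)
    (W := fun (i : N) ω => X ω i u * X ω (g i) v)
    (hpairs.comp (fun _ x => x.1 u * x.2 v) (fun _ => by fun_prop))
    (fun i => (hme _ _).mul (hme _ _)) ht (h.momentGamma_pos hα a u)
    (pow_pos hκ' 2) (half_pos hα) hsqi hsq
    (fun i => (h.integrable_exp_mul hα hκ' hκ i (g i) u v).1)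
    (fun i => (h.integrable_exp_mul hα hκ' hκ i (g i) u v).2)
    (by rw [hcard]; exact hMt) (by rw [hcard]; exact hst)
  rw [hcard] at key
  simp only [hE, sub_zero] at key
  convert key using 6 with ω
  rw [← Finset.sum_coe_sort N]

/-- Deviation of one entry of `Xᵀ G X`. -/
theorem measureReal_entry_le [IsProbabilityMeasure μ] (h : CovariateCondition α κ X ν μ) [IsProbabilityMeasure ν]
    (hα : 0 < α) (hκ' : 0 < κ') (hκ : κ < κ') (a : Fin p → ℝ) {t : ℝ} (ht : Real.log 2 ≤ t)
    {m : ℕ} (hm : 0 < m) (hn : n = 2 * m)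
    (hMt : κ' ^ 2 * (2 * Real.log (2 * m)) ^ (1 / (α / 2)) * √t ≤ √(momentGamma a ν * m))
    (hst : 8 * t ≤ (√(momentGamma a ν * m * t) / κ' ^ 2) ^ min (α / 2) 1)
    {G : Matrix (Fin n) (Fin n) ℝ}
    (hG : G ∈ crossHalfPermMatrices (Fin n) ∨ G ∈ balancedSignMatrices (Fin n)) (u v : Fin p) :
    μ.real {ω | 16 * √(momentGamma a ν * m * t) ≤ |((X ω)ᵀ * G * X ω) u v|}
      ≤ 6 * Real.exp (-t) := by
  set T := 8 * √(momentGamma a ν * m * t) with hT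
  have hcomb : ∀ A B : Ω → ℝ, (∀ ω, |((X ω)ᵀ * G * X ω) u v| ≤ |A ω| + |B ω|) →
      μ.real {ω | T ≤ |A ω|} ≤ 3 * Real.exp (-t) → μ.real {ω | T ≤ |B ω|} ≤ 3 * Real.exp (-t) →
      μ.real {ω | 16 * √(momentGamma a ν * m * t) ≤ |((X ω)ᵀ * G * X ω) u v|}
        ≤ 6 * Real.exp (-t) := by
    intro A B hAB hA hB
    have hsub : {ω | 16 * √(momentGamma a ν * m * t) ≤ |((X ω)ᵀ * G * X ω) u v|} ⊆
        {ω | T ≤ |A ω|} ∪ {ω | T ≤ |B ω|} := by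
      intro ω hω
      simp only [Set.mem_ofPred_eq, Set.mem_union] at hω ⊢
      by_contra! hcon
      linarith [hAB ω]
    refine (measureReal_mono hsub).trans ((measureReal_union_le _ _).trans ?_)
    linarith
  rcases hG with ⟨g, N₁, N₂, hd, hu, hc, h12, h21, rfl⟩ | ⟨s, hs, hc, rfl⟩
  · have hcard : N₁.card + N₂.card = n := by
      rw [← Finset.card_union_of_disjoint hd, hu, Finset.card_univ, Fintype.card_fin]
    refine hcomb (fun ω => ∑ i ∈ N₁, X ω i u * X ω (g i) v)
      (fun ω => ∑ i ∈ N₂, X ω i u * X ω (g i) v) (fun ω => ?_) ?_ ?_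
    · rw [transpose_mul_permMatrix_mul_apply, ← hu, Finset.sum_union hd]
      exact abs_add_le _ _
    · exact h.measureReal_sum_cross_rows_le hα hκ' hκ a ht hm hMt hst (by omega) g.injective
        (fun i hi => Finset.disjoint_right.1 hd (h12 i hi)) u v
    · exact h.measureReal_sum_cross_rows_le hα hκ' hκ a ht hm hMt hst (by omega) g.injective
        (fun i hi => Finset.disjoint_left.1 hd (h21 i hi)) u v
  · classical
    set N₁ : Finset (Fin n) := Finset.univ.filter fun i => s i = 1 with hN₁
    set N₂ : Finset (Fin n) := Finset.univ.filter fun i => s i = -1 with hN₂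
    have hd : Disjoint N₁ N₂ := by
      rw [Finset.disjoint_left]
      intro i h1 h2
      simp only [hN₁, hN₂, Finset.mem_filter, Finset.mem_univ, true_and] at h1 h2
      linarith
    have hu : N₁ ∪ N₂ = Finset.univ := by
      ext i
      simpa [hN₁, hN₂] using hs i
    have hc' : N₁.card = N₂.card := by
      simpa [hN₁, hN₂, Nat.card_eq_fintype_card, Fintype.card_subtype] using hc
    have hcard : N₁.card + N₂.card = n := by
      rw [← Finset.card_union_of_disjoint hd, hu, Finset.card_univ, Fintype.card_fin]
    refine hcomb (fun ω => ∑ i ∈ N₁, (X ω i u * X ω i v - ∫ x, x u * x v ∂ν))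
      (fun ω => ∑ i ∈ N₂, (X ω i u * X ω i v - ∫ x, x u * x v ∂ν)) (fun ω => ?_)
      (h.measureReal_sum_same_row_le hα hκ' hκ a ht hm hMt hst (by omega) u v)
      (h.measureReal_sum_same_row_le hα hκ' hκ a ht hm hMt hst (by omega) u v)
    rw [transpose_mul_diagonal_mul_apply, ← hu, Finset.sum_union hd]
    have e1 : ∑ i ∈ N₁, s i * (X ω i u * X ω i v) = ∑ i ∈ N₁, X ω i u * X ω i v :=
      Finset.sum_congr rfl fun i hi => by rw [(Finset.mem_filter.1 hi).2, one_mul]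
    have e2 : ∑ i ∈ N₂, s i * (X ω i u * X ω i v) = -∑ i ∈ N₂, X ω i u * X ω i v := by
      rw [← Finset.sum_neg_distrib]
      exact Finset.sum_congr rfl fun i hi => by rw [(Finset.mem_filter.1 hi).2, neg_one_mul]
    rw [e1, e2, Finset.sum_sub_distrib, Finset.sum_sub_distrib, Finset.sum_const,
      Finset.sum_const, hc']
    refine le_trans (le_of_eq ?_) (abs_sub _ _)
    congr 1
    ring

end CovariateCondition

/-- The two index halves of an admissible matrix have equal size. -/
theorem even_of_mem {n : ℕ} {G : Matrix (Fin n) (Fin n) ℝ}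
    (hG : G ∈ crossHalfPermMatrices (Fin n) ∨ G ∈ balancedSignMatrices (Fin n)) :
    ∃ m, n = 2 * m := by
  classical
  rcases hG with ⟨g, N₁, N₂, hd, hu, hc, -⟩ | ⟨s, hs, hc, -⟩
  · refine ⟨N₁.card, ?_⟩
    have := Finset.card_union_of_disjoint hd
    rw [hu, Finset.card_univ, Fintype.card_fin] at this
    omega
  · refine ⟨(Finset.univ.filter fun i => s i = 1).card, ?_⟩
    have h1 := Finset.card_filter_add_card_filter_not (s := (Finset.univ : Finset (Fin n)))
      (fun i => s i = 1)
    have h2 : (Finset.univ.filter fun i => ¬ s i = 1) = Finset.univ.filter fun i => s i = -1 := by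
      ext i
      rcases hs i with h | h <;> simp [h] <;> norm_num
    rw [h2, Finset.card_univ, Fintype.card_fin] at h1
    have h3 : (Finset.univ.filter fun i => s i = 1).card
        = (Finset.univ.filter fun i => s i = -1).card := by
      simpa [Nat.card_eq_fintype_card, Fintype.card_subtype] using hc
    omega

/-- Room for a scale above `κ` in the sample size condition. -/
theorem SampleSizeCondition.exists_scale {p n : ℕ} {C α κ : ℝ} {a : Fin p → ℝ}
    {ν : Measure (Fin p → ℝ)} (h : SampleSizeCondition C α κ n a ν) (hn : 0 < n) (hp : 0 < p)
    (hΓ : 0 < momentGamma a ν) :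
    ∃ κ', 0 < κ' ∧ κ < κ' ∧ 4 * C ^ 2 * (κ' ^ 2) ^ 2 * Real.log (2 * n) ^ (4 / α) *
      (3 * Real.log (p * n)) ^ (4 / min α 2 - 1) ≤ momentGamma a ν * n := by
  have hn1 : (1 : ℝ) ≤ n := by exact_mod_cast hn
  have hp1 : (1 : ℝ) ≤ p := by exact_mod_cast hp
  have h1 := (le_max_left _ _).trans_lt h
  set A := Real.log (2 * n) ^ (4 / α) * (3 * Real.log (p * n)) ^ (4 / min α 2 - 1) with hA
  have hA0 : 0 ≤ A := mul_nonneg (Real.rpow_nonneg (Real.log_nonneg (by linarith)) _)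
    (Real.rpow_nonneg (mul_nonneg (by norm_num) (Real.log_nonneg (by nlinarith))) _)
  have hκs : κ ^ 2 ≤ kappaStar κ a ν := by
    rw [kappaStar]
    nlinarith [sq_nonneg κ,
      le_max_right (√(a ⬝ᵥ a) * √(lambdaMax (covMatrix ν)) / √(lambdaMin (covMatrix ν))) 1]
  rw [div_lt_iff₀ hΓ] at h1
  have h2 : (4 * C ^ 2 * A) * κ ^ 4 < momentGamma a ν * n := by
    calc (4 * C ^ 2 * A) * κ ^ 4 = (4 * C ^ 2 * A) * (κ ^ 2) ^ 2 := by ring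
      _ ≤ (4 * C ^ 2 * A) * kappaStar κ a ν ^ 2 := by gcongr
      _ < _ := by rw [hA]; linarith
  obtain ⟨κ', h3, h4, h5⟩ := exists_gt_scale h2
  refine ⟨κ', h3, h4, ?_⟩
  rw [hA] at h5
  linarith

theorem lemma2 (α : ℝ) (hα : 0 < α) :
    ∃ C : ℝ, 0 < C ∧
      ∀ (Ω : Type*) [MeasurableSpace Ω] (μ : Measure Ω) [IsProbabilityMeasure μ]
        (n p : ℕ) (_ : 0 < p) (κ : ℝ) (a : Fin p → ℝ)
        (ν : Measure (Fin p → ℝ)) (X : Ω → Matrix (Fin n) (Fin p) ℝ)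
        (𝒢 : Finset (Matrix (Fin n) (Fin n) ℝ)),
        CovariateCondition α κ X ν μ →
        SampleSizeCondition C α κ n a ν →
        𝒢.Nonempty →
        ((𝒢 : Set (Matrix (Fin n) (Fin n) ℝ)) ⊆ crossHalfPermMatrices (Fin n) ∨
          (𝒢 : Set (Matrix (Fin n) (Fin n) ℝ)) ⊆ balancedSignMatrices (Fin n) ∨
          ∃ (c : ℕ) (L : Fin c → Finset (Fin n)), IsEqualPartition L ∧
            (𝒢 : Set (Matrix (Fin n) (Fin n) ℝ)) ⊆ clusterPermMatrices L) →
        μ.real {ω | 8 * √(2 * momentGamma a ν * (Real.log (p * n) + 2 * Real.log p) / n) ≤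
            (1 / (𝒢.card : ℝ)) *
              ∑ G ∈ 𝒢, maxAbsEntry ((1 / (n : ℝ)) • ((X ω)ᵀ * G * X ω))}
          ≤ 6 * (𝒢.card : ℝ) / (n * p) := by
  refine ⟨sampleConstant α, by unfold sampleConstant; positivity, ?_⟩
  intro Ω _ μ _ n p hp κ a ν X 𝒢 hcov hsize hne hG
  have hn : 0 < n := by
    by_contra hn
    obtain rfl : n = 0 := by omega
    have h1 := (le_max_left _ _).trans_lt hsize
    have h2 : Real.log (2 * ((0 : ℕ) : ℝ)) ^ (4 / α) = 0 := by
      simp [Real.zero_rpow (div_pos four_pos hα).ne']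
    rw [h2] at h1
    simp at h1
  have hn0 : (0 : ℝ) < n := by exact_mod_cast hn
  have hp0 : (0 : ℝ) < p := by exact_mod_cast hp
  have : NeZero p := ⟨hp.ne'⟩
  have : IsProbabilityMeasure ν :=
    (hcov.hasLaw ⟨0, hn⟩).isProbabilityMeasure_iff.1 inferInstance
  have hmem : ∀ G ∈ 𝒢, G ∈ crossHalfPermMatrices (Fin n) ∨ G ∈ balancedSignMatrices (Fin n) := by
    intro G hGm
    rcases hG with h | h | ⟨c, L, hL, h⟩
    · exact Or.inl (h hGm)
    · exact Or.inr (h hGm)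
    · exact Or.inl (clusterPermMatrices_subset hL (h hGm))
  obtain ⟨m, hnm⟩ : ∃ m, n = 2 * m := by
    obtain ⟨G, hGm⟩ := hne
    exact even_of_mem (hmem G hGm)
  have hm : 0 < m := by omega
  have hnm' : (n : ℝ) = 2 * m := by exact_mod_cast hnm
  have hΓ := hcov.momentGamma_pos hα a ⟨0, hp⟩
  obtain ⟨κ', hκ', hκ, hsz⟩ := hsize.exists_scale hn hp hΓ
  have hw := neg_log_weight hn hp
  rw [hnm'] at hsz
  obtain ⟨ht, hMt, hst⟩ := truncation_bounds hα (pow_pos hκ' 2) hm hp hsz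
  rw [← hnm'] at ht
  rw [← hnm'] at hst
  rw [show Real.log (p * (2 * (m : ℝ))) = Real.log (p * n) by rw [hnm']] at hMt
  set t := Real.log (p * n) + 2 * Real.log p with htdef
  set Γ := momentGamma a ν with hΓdef
  have ht0 : 0 < t := (Real.log_pos (by norm_num)).trans_le ht
  have hthr : 8 * √(2 * Γ * t / n) * n = 16 * √(Γ * m * t) := by
    have e : 2 * Γ * t / n = Γ * m * t * (2 / n) ^ 2 := by
      rw [hnm']; field_simp
    rw [e, Real.sqrt_mul (by positivity), Real.sqrt_sq (by positivity)]
    field_simp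
    norm_num
  have hsub : {ω | 8 * √(2 * Γ * t / n) ≤ (1 / (𝒢.card : ℝ)) *
        ∑ G ∈ 𝒢, maxAbsEntry ((1 / (n : ℝ)) • ((X ω)ᵀ * G * X ω))} ⊆
      ⋃ q ∈ 𝒢 ×ˢ (Finset.univ : Finset (Fin p × Fin p)),
        {ω | 16 * √(Γ * m * t) ≤ |((X ω)ᵀ * q.1 * X ω) q.2.1 q.2.2|} := by
    intro ω hω
    simp only [Set.mem_ofPred_eq] at hω
    have hc : (0 : ℝ) < 𝒢.card := by exact_mod_cast hne.card_pos
    rw [one_div_mul_eq_div, le_div_iff₀ hc] at hω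
    obtain ⟨G, hGm, hle⟩ := Finset.exists_le_of_sum_le hne
      (f := fun _ => 8 * √(2 * Γ * t / n))
      (g := fun G => maxAbsEntry ((1 / (n : ℝ)) • ((X ω)ᵀ * G * X ω)))
      (by rw [Finset.sum_const, nsmul_eq_mul, mul_comm]; exact hω)
    obtain ⟨u, v, huv⟩ := exists_le_abs_of_le_maxAbsEntry hle
    rw [Matrix.smul_apply, smul_eq_mul, abs_mul, abs_of_pos (by positivity), one_div_mul_eq_div,
      le_div_iff₀ hn0, hthr] at huv
    simp only [Set.mem_iUnion]
    exact ⟨(G, u, v), by simpa using hGm, huv⟩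
  calc _ ≤ μ.real (⋃ q ∈ 𝒢 ×ˢ (Finset.univ : Finset (Fin p × Fin p)),
        {ω | 16 * √(Γ * m * t) ≤ |((X ω)ᵀ * q.1 * X ω) q.2.1 q.2.2|}) := measureReal_mono hsub (measure_ne_top _ _)
    _ ≤ ∑ q ∈ 𝒢 ×ˢ (Finset.univ : Finset (Fin p × Fin p)),
        μ.real {ω | 16 * √(Γ * m * t) ≤ |((X ω)ᵀ * q.1 * X ω) q.2.1 q.2.2|} :=
      measureReal_biUnion_finset_le _ _
    _ ≤ ∑ q ∈ 𝒢 ×ˢ (Finset.univ : Finset (Fin p × Fin p)), 6 * Real.exp (-t) :=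
      Finset.sum_le_sum fun q hq => hcov.measureReal_entry_le hα hκ' hκ a ht hm hnm hMt hst
        (hmem q.1 (Finset.mem_product.1 hq).1) q.2.1 q.2.2
    _ = 6 * (𝒢.card : ℝ) / (n * p) := by
      rw [Finset.sum_const, hw, Finset.card_product, Finset.card_univ, Fintype.card_prod,
        Fintype.card_fin, nsmul_eq_mul]
      push_cast
      field_simp
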